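/- Let $m$ be a non-negative integer, let $d_1\ge\dots\ge d_m$ be real numbers and let $w_1,\dots,w_m$ be a basis of $\mathbb{R}^m$. For real $t>0$ define the real symmetric $m\times m$ matrix $$H(t):=\Bigl[\sum_{i=1}^m e^{t d_i}\,w_i w_i^T\Bigr]^{1/t},$$ where for a symmetric positive semidefinite matrix $A=V\,\mathrm{diag}(a_1,\dots,a_m)\,V^T$ with $V$ orthogonal, $A^{1/t}:=V\,\mathrm{diag}(a_1^{1/t},\dots,a_m^{1/t})\,V^T$. Let $u_1,\dots,u_m$ be the orthonormal basis of $\mathbb{R}^m$ that results from applying the Gram–Schmidt orthonormalization process to $w_1,\dots,w_m$. Then, as $t\to\infty$ through the real numbers: (a) for each $j=1,\dots,m$, the $j$th largest eigenvalue of $H(t)$ (counted with multiplicity) converges to $e^{d_j}$; (b) for each $j=1,\dots,m$, $H(t)u_j\to e^{d_j}u_j$; (c) $\lim_{t\to\infty}H(t)$ exists, its eigenvalues, counted with multiplicity, are $e^{d_1},\dots,e^{d_m}$, and $u_j$ is an eigenvector for the eigenvalue $e^{d_j}$ for each $j=1,\dots,m$. -/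

import Mathlib

open Filter Topology

namespace SPDLimit

/-- The `t`-th root `A^{1/t}` of a real symmetric positive semidefinite matrix: the eigenvectors of
`A` are kept and every eigenvalue `x` is replaced by `x ^ (1 / t)` (functional calculus). -/
noncomputable def matrixRoot {m : ℕ} (t : ℝ) (A : Matrix (Fin m) (Fin m) ℝ) :
    Matrix (Fin m) (Fin m) ℝ :=
  cfc (fun x : ℝ => x ^ (1 / t)) A

/-- The matrix `∑ i, e^{t d_i} w_i w_iᵀ`. -/
noncomputable def weightedSum {m : ℕ} (d : Fin m → ℝ)
    (w : Module.Basis (Fin m) ℝ (EuclideanSpace ℝ (Fin m))) (t : ℝ) :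
    Matrix (Fin m) (Fin m) ℝ :=
  ∑ i, Real.exp (t * d i) • Matrix.vecMulVec (w i).ofLp (w i).ofLp

/-- `H(t) = [∑ i, e^{t d_i} w_i w_iᵀ]^{1/t}`. -/
noncomputable def H {m : ℕ} (d : Fin m → ℝ)
    (w : Module.Basis (Fin m) ℝ (EuclideanSpace ℝ (Fin m))) (t : ℝ) :
    Matrix (Fin m) (Fin m) ℝ :=
  matrixRoot t (weightedSum d w t)

theorem isHermitian_H {m : ℕ} (d : Fin m → ℝ)
    (w : Module.Basis (Fin m) ℝ (EuclideanSpace ℝ (Fin m))) (t : ℝ) :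
    (H d w t).IsHermitian :=
  cfc_predicate (R := ℝ) (p := IsSelfAdjoint) (fun x : ℝ => x ^ (1 / t)) (weightedSum d w t)

/-- The `j`-th largest eigenvalue, counted with multiplicity (`j = 0` is the largest), of a real
symmetric matrix; `eigenvalues₀` lists the eigenvalues in decreasing order. -/
noncomputable def nthLargestEigenvalue {m : ℕ} {A : Matrix (Fin m) (Fin m) ℝ}
    (hA : A.IsHermitian) (j : Fin m) : ℝ :=
  hA.eigenvalues₀ (Fin.cast (Fintype.card_fin m).symm j)

/-- The orthonormal basis that results from applying the Gram-Schmidt orthonormalization process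
to the basis `w`. -/
noncomputable def gramSchmidtONB {m : ℕ}
    (w : Module.Basis (Fin m) ℝ (EuclideanSpace ℝ (Fin m))) :
    OrthonormalBasis (Fin m) ℝ (EuclideanSpace ℝ (Fin m)) :=
  OrthonormalBasis.mk
    (InnerProductSpace.gramSchmidtNormed_orthonormal (𝕜 := ℝ) w.linearIndependent)
    (by rw [InnerProductSpace.span_gramSchmidtNormed_range, InnerProductSpace.span_gramSchmidt,
      w.span_eq])

end SPDLimit

/-! Gram–Schmidt preserves the flag of spans of initial segments, so the change of basis between `w`
and `u` is triangular in both directions. Since the weights `e^{t d_i}` decrease in `i`,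
triangularity gives `c ∑ e^{t d_i} u_i u_iᵀ ≤ ∑ e^{t d_i} w_i w_iᵀ ≤ C ∑ e^{t d_i} u_i u_iᵀ` in the
Löwner order, with `c, C > 0` independent of `t` (`exists_weighted_sum_le`). For `t ≥ 1` the `t`-th
root is operator monotone (`posSemidef_matrixRoot_sub`), hence `c^{1/t} L ≤ H(t) ≤ C^{1/t} L` with
`L = ∑ e^{d_i} u_i u_iᵀ`. As `c^{1/t}` and `C^{1/t}` tend to 1, squeezing the quadratic forms yields
`H(t) → L`, and squeezing the ordered eigenvalues (`le_of_quadraticForm_le`) yields (a). -/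

namespace SPDLimit

/-! ### Complexification and operator monotonicity of roots -/

/-- The inclusion of the real matrices into the complex matrices. -/
noncomputable def complexification (m : ℕ) :
    Matrix (Fin m) (Fin m) ℝ →⋆ₐ[ℝ] Matrix (Fin m) (Fin m) ℂ :=
  { (Complex.ofRealAm.mapMatrix : Matrix (Fin m) (Fin m) ℝ →ₐ[ℝ] Matrix (Fin m) (Fin m) ℂ) with
    map_star' := fun A => by
      ext i j
      simp [Matrix.star_apply] }

theorem complexification_apply {m : ℕ} (A : Matrix (Fin m) (Fin m) ℝ) (i j : Fin m) :
    complexification m A i j = (A i j : ℂ) := rfl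

theorem continuous_complexification (m : ℕ) : Continuous (complexification m) :=
  continuous_id.matrix_map Complex.continuous_ofReal

open scoped ComplexOrder MatrixOrder in
theorem complexification_posSemidef {m : ℕ} {A : Matrix (Fin m) (Fin m) ℝ}
    (hA : A.PosSemidef) : (complexification m A).PosSemidef := by
  obtain ⟨B, rfl⟩ := CStarAlgebra.nonneg_iff_eq_star_mul_self.mp hA.nonneg
  rw [map_mul, map_star]
  exact Matrix.posSemidef_conjTranspose_mul_self _

open scoped ComplexOrder in
theorem posSemidef_of_complexification {m : ℕ} {A : Matrix (Fin m) (Fin m) ℝ}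
    (hA : (complexification m A).PosSemidef) : A.PosSemidef := by
  refine .of_dotProduct_mulVec_nonneg ?_ fun x => ?_
  · ext i j
    have := congrFun (congrFun hA.1 i) j
    simpa [Matrix.conjTranspose_apply, complexification_apply] using this
  · have h := hA.dotProduct_mulVec_nonneg (fun i => (x i : ℂ))
    have e : star (fun i => (x i : ℂ)) ⬝ᵥ (complexification m A).mulVec (fun i => (x i : ℂ)) =
        ((star x ⬝ᵥ A.mulVec x : ℝ) : ℂ) := by
      simp [dotProduct, Matrix.mulVec, complexification_apply]
    rw [e] at h
    exact_mod_cast h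

-- A continuous ⋆-homomorphism commutes with the functional calculus. This lets operator
-- monotonicity in the C⋆-algebra of complex matrices descend to real ones.
open scoped ComplexOrder MatrixOrder Matrix.Norms.L2Operator in
theorem complexification_matrixRoot {m : ℕ} (t : ℝ) {A : Matrix (Fin m) (Fin m) ℝ}
    (hA : A.PosSemidef) :
    complexification m (matrixRoot t A) = complexification m A ^ (1 / t) := by
  have hA' := (complexification_posSemidef hA).nonneg
  rw [matrixRoot, CFC.rpow_eq_cfc_real hA']
  exact StarAlgHom.map_cfc (complexification m) _ A (A.finite_real_spectrum.continuousOn _)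
    (continuous_complexification m) hA.1 hA'.isSelfAdjoint

open scoped ComplexOrder MatrixOrder Matrix.Norms.L2Operator in
/-- The Löwner–Heinz inequality for real matrices. -/
theorem posSemidef_matrixRoot_sub {m : ℕ} {t : ℝ} (ht : 1 ≤ t)
    {A B : Matrix (Fin m) (Fin m) ℝ} (hA : A.PosSemidef) (hB : B.PosSemidef)
    (hAB : (B - A).PosSemidef) : (matrixRoot t B - matrixRoot t A).PosSemidef := by
  apply posSemidef_of_complexification
  rw [map_sub, complexification_matrixRoot t hA, complexification_matrixRoot t hB]
  have h : complexification m A ≤ complexification m B := by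
    rw [Matrix.le_iff, ← map_sub]
    exact complexification_posSemidef hAB
  have ht' : 1 / t ∈ Set.Icc (0 : ℝ) 1 :=
    ⟨by positivity, by rw [div_le_one (by positivity)]; exact ht⟩
  exact Matrix.le_iff.mp (CFC.monotone_rpow ht' h)

/-! ### Weighted sums of rank-one matrices -/

/-- The matrix `∑ i, a i • v i (v i)ᵀ`. -/
noncomputable def sumVecMulVec {m : ℕ} (a : Fin m → ℝ) (v : Fin m → EuclideanSpace ℝ (Fin m)) :
    Matrix (Fin m) (Fin m) ℝ :=
  ∑ i, a i • Matrix.vecMulVec (v i).ofLp (v i).ofLp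

theorem toEuclideanLin_sumVecMulVec {m : ℕ} (a : Fin m → ℝ)
    (v : Fin m → EuclideanSpace ℝ (Fin m)) (x : EuclideanSpace ℝ (Fin m)) :
    Matrix.toEuclideanLin (sumVecMulVec a v) x = ∑ i, (a i * inner ℝ (v i) x) • v i := by
  ext k
  simp only [sumVecMulVec, Matrix.toLpLin_apply, Matrix.sum_mulVec, Matrix.smul_mulVec,
    Matrix.vecMulVec_mulVec, WithLp.ofLp_sum, WithLp.ofLp_smul, Finset.sum_apply, Pi.smul_apply,
    PiLp.inner_apply, dotProduct, smul_eq_mul]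
  refine Finset.sum_congr rfl fun i _ => ?_
  simp [mul_comm, mul_left_comm]

theorem toEuclideanLin_sumVecMulVec_basis {m : ℕ} (a : Fin m → ℝ)
    (v : OrthonormalBasis (Fin m) ℝ (EuclideanSpace ℝ (Fin m))) (j : Fin m) :
    Matrix.toEuclideanLin (sumVecMulVec a v) (v j) = a j • v j := by
  rw [toEuclideanLin_sumVecMulVec, Finset.sum_eq_single j]
  · simp
  · intro i _ hij
    simp [v.inner_eq_zero hij]
  · simp

theorem inner_sumVecMulVec {m : ℕ} (a : Fin m → ℝ)
    (v : Fin m → EuclideanSpace ℝ (Fin m)) (x : EuclideanSpace ℝ (Fin m)) :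
    inner ℝ x (Matrix.toEuclideanLin (sumVecMulVec a v) x) = ∑ i, a i * inner ℝ (v i) x ^ 2 := by
  rw [toEuclideanLin_sumVecMulVec, inner_sum]
  refine Finset.sum_congr rfl fun i _ => ?_
  rw [inner_smul_right, real_inner_comm (v i) x]
  ring

theorem eq_sumVecMulVec {m : ℕ} {A : Matrix (Fin m) (Fin m) ℝ} {a : Fin m → ℝ}
    {v : OrthonormalBasis (Fin m) ℝ (EuclideanSpace ℝ (Fin m))}
    (h : ∀ j, Matrix.toEuclideanLin A (v j) = a j • v j) : A = sumVecMulVec a v := by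
  apply Matrix.toEuclideanLin.injective
  refine v.toBasis.ext fun j => ?_
  rw [v.coe_toBasis, h, toEuclideanLin_sumVecMulVec_basis]

theorem isHermitian_sumVecMulVec {m : ℕ} (a : Fin m → ℝ)
    (v : Fin m → EuclideanSpace ℝ (Fin m)) : (sumVecMulVec a v).IsHermitian := by
  ext i j
  simp [sumVecMulVec, Matrix.sum_apply, Matrix.vecMulVec_apply, mul_comm]

theorem posSemidef_iff_inner {m : ℕ} {A : Matrix (Fin m) (Fin m) ℝ} (hA : A.IsHermitian) :
    A.PosSemidef ↔ ∀ x, 0 ≤ inner ℝ x (Matrix.toEuclideanLin A x) := by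
  have e : ∀ x : EuclideanSpace ℝ (Fin m), inner ℝ x (Matrix.toEuclideanLin A x) =
      star x.ofLp ⬝ᵥ A.mulVec x.ofLp := by
    intro x
    simp [EuclideanSpace.inner_eq_star_dotProduct, dotProduct_comm]
  rw [Matrix.posSemidef_iff_dotProduct_mulVec]
  simp only [hA, true_and, e]
  exact ⟨fun h x => h x.ofLp, fun h x => h (WithLp.toLp 2 x)⟩

theorem posSemidef_sumVecMulVec {m : ℕ} {a : Fin m → ℝ} (ha : ∀ i, 0 ≤ a i)
    (v : Fin m → EuclideanSpace ℝ (Fin m)) : (sumVecMulVec a v).PosSemidef := by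
  rw [posSemidef_iff_inner (isHermitian_sumVecMulVec a v)]
  intro x
  rw [inner_sumVecMulVec]
  exact Finset.sum_nonneg fun i _ => mul_nonneg (ha i) (sq_nonneg _)

/-- On the finite spectrum `f` agrees with its Lagrange interpolant, and a polynomial in a matrix
acts on an eigenvector by evaluation at the eigenvalue. -/
theorem cfc_sumVecMulVec {m : ℕ} (f : ℝ → ℝ) (a : Fin m → ℝ)
    (v : OrthonormalBasis (Fin m) ℝ (EuclideanSpace ℝ (Fin m))) :
    cfc f (sumVecMulVec a v) = sumVecMulVec (f ∘ a) v := by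
  classical
  set A := sumVecMulVec a v with hA
  set s : Finset ℝ := A.finite_real_spectrum.toFinset
  set p : Polynomial ℝ := Lagrange.interpolate s id f
  have hp : ∀ x ∈ spectrum ℝ A, p.eval x = f x := fun x hx =>
    Lagrange.eval_interpolate_at_node f Function.injective_id.injOn
      (A.finite_real_spectrum.mem_toFinset.mpr hx)
  have hcfc : cfc f A = Polynomial.aeval A p := by
    rw [← cfc_polynomial p A (isHermitian_sumVecMulVec a v)]
    exact cfc_congr fun x hx => (hp x hx).symm
  refine eq_sumVecMulVec fun j => ?_
  have hj : Module.End.HasEigenvector (Matrix.toEuclideanLin A) (a j) (v j) :=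
    Module.End.hasEigenvector_iff.mpr ⟨Module.End.mem_eigenspace_iff.mpr
      (toEuclideanLin_sumVecMulVec_basis a v j), v.orthonormal.ne_zero j⟩
  have hspec : a j ∈ spectrum ℝ A := by
    rw [← Matrix.spectrum_toLpLin 2]
    exact (Module.End.hasEigenvalue_of_hasEigenvector hj).mem_spectrum
  have key := Module.End.aeval_apply_of_hasEigenvector (p := p) hj
  rw [hp _ hspec] at key
  rw [hcfc, Function.comp_apply, ← key]
  have := Polynomial.aeval_algHom_apply (Matrix.toLpLinAlgEquiv (n := Fin m) (R := ℝ) 2).toAlgHom A p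
  exact congrArg (fun T => T (v j)) this.symm

/-! ### Ordered eigenvalues -/

/-- Monotonicity of ordered eigenvalues. -/
theorem le_of_quadraticForm_le {m : ℕ} {a b : Fin m → ℝ} (ha : Antitone a) (hb : Antitone b)
    (u v : OrthonormalBasis (Fin m) ℝ (EuclideanSpace ℝ (Fin m)))
    (h : ∀ x, ∑ i, a i * inner ℝ (u i) x ^ 2 ≤ ∑ i, b i * inner ℝ (v i) x ^ 2) (j : Fin m) :
    a j ≤ b j := by
  classical
  -- These are `m - 1` linear conditions, so some `x ≠ 0` is orthogonal to every `u i` with `i > j`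
  -- and every `v i` with `i < j`. For it, `a j ‖x‖²` and `b j ‖x‖²` enclose the two forms.
  let f : EuclideanSpace ℝ (Fin m) →ₗ[ℝ] ({i : Fin m // i ≠ j} → ℝ) :=
    LinearMap.pi fun i => if j < i.1 then innerₛₗ ℝ (u i) else innerₛₗ ℝ (v i)
  have hf : LinearMap.ker f ≠ ⊥ := by
    apply LinearMap.ker_ne_bot_of_finrank_lt
    have := j.pos
    simp
    omega
  obtain ⟨x, hx, hx0⟩ := Submodule.exists_mem_ne_zero_of_ne_bot hf
  have hfx : ∀ i : Fin m, i ≠ j →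
      (if j < i then innerₛₗ ℝ (u i) else innerₛₗ ℝ (v i)) x = 0 :=
    fun i hi => congrFun (LinearMap.mem_ker.mp hx) ⟨i, hi⟩
  have hu : ∀ i, j < i → inner ℝ (u i) x = 0 := fun i hi => by
    simpa [hi] using hfx i hi.ne'
  have hv : ∀ i, i < j → inner ℝ (v i) x = 0 := fun i hi => by
    simpa [hi.not_gt] using hfx i hi.ne
  have hnorm : ∀ e : OrthonormalBasis (Fin m) ℝ (EuclideanSpace ℝ (Fin m)),
      ∑ i, inner ℝ (e i) x ^ 2 = ‖x‖ ^ 2 := fun e => by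
    simpa using e.sum_sq_norm_inner_right x
  have h1 : a j * ‖x‖ ^ 2 ≤ ∑ i, a i * inner ℝ (u i) x ^ 2 := by
    rw [← hnorm u, Finset.mul_sum]
    refine Finset.sum_le_sum fun i _ => ?_
    rcases le_or_gt i j with hi | hi
    · exact mul_le_mul_of_nonneg_right (ha hi) (sq_nonneg _)
    · simp [hu i hi]
  have h2 : ∑ i, b i * inner ℝ (v i) x ^ 2 ≤ b j * ‖x‖ ^ 2 := by
    rw [← hnorm v, Finset.mul_sum]
    refine Finset.sum_le_sum fun i _ => ?_
    rcases le_or_gt j i with hi | hi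
    · exact mul_le_mul_of_nonneg_right (hb hi) (sq_nonneg _)
    · simp [hv i hi]
  exact le_of_mul_le_mul_right (h1.trans ((h x).trans h2)) (by positivity)

theorem nthLargestEigenvalue_antitone {m : ℕ} {A : Matrix (Fin m) (Fin m) ℝ}
    (hA : A.IsHermitian) : Antitone (nthLargestEigenvalue hA) :=
  fun _ _ hij => hA.eigenvalues₀_antitone hij

theorem exists_eq_sumVecMulVec {m : ℕ} {A : Matrix (Fin m) (Fin m) ℝ} (hA : A.IsHermitian) :
    ∃ v : OrthonormalBasis (Fin m) ℝ (EuclideanSpace ℝ (Fin m)),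
      A = sumVecMulVec (nthLargestEigenvalue hA) v := by
  have hs := Matrix.isSymmetric_toEuclideanLin_iff.mpr hA
  refine ⟨(hs.eigenvectorBasis finrank_euclideanSpace).reindex (finCongr (Fintype.card_fin m)),
    eq_sumVecMulVec fun j => ?_⟩
  rw [OrthonormalBasis.reindex_apply]
  exact hs.apply_eigenvectorBasis finrank_euclideanSpace _

/-! ### Triangular changes of basis -/

/-- If each `w i` lies in the span of the `v j` with `j ≤ i`, then for antitone nonnegative weights
the weighted sum of squares along `w` is dominated by the one along `v`. -/
theorem exists_weighted_sum_le {m : ℕ} {w : Fin m → EuclideanSpace ℝ (Fin m)}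
    (v : Module.Basis (Fin m) ℝ (EuclideanSpace ℝ (Fin m)))
    (h : ∀ i, w i ∈ Submodule.span ℝ (v '' Set.Iic i)) :
    ∃ C : ℝ, 0 < C ∧ ∀ a : Fin m → ℝ, Antitone a → (∀ i, 0 ≤ a i) → ∀ x,
      ∑ i, a i * inner ℝ (w i) x ^ 2 ≤ C * ∑ i, a i * inner ℝ (v i) x ^ 2 := by
  set r : Fin m → Fin m → ℝ := fun i j => v.repr (w i) j
  have hr : ∀ i j, i < j → r i j = 0 := fun i j hij => by
    by_contra hne
    exact hij.not_ge (v.mem_span_image.mp (h i) (Finsupp.mem_support_iff.mpr hne))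
  -- The constant comes from Cauchy–Schwarz and does not involve `a`; the `1 +` only secures
  -- positivity.
  refine ⟨1 + ∑ i, ∑ j, r i j ^ 2, by positivity, fun a ha ha0 x => ?_⟩
  set S := ∑ j, a j * inner ℝ (v j) x ^ 2
  have hS : 0 ≤ S := Finset.sum_nonneg fun i _ => mul_nonneg (ha0 i) (sq_nonneg _)
  have key : ∀ i, a i * inner ℝ (w i) x ^ 2 ≤ (∑ j, r i j ^ 2) * S := by
    intro i
    have e : inner ℝ (w i) x = ∑ j, r i j * if j ≤ i then inner ℝ (v j) x else 0 := by
      conv_lhs => rw [← v.sum_repr (w i), sum_inner]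
      refine Finset.sum_congr rfl fun j _ => ?_
      rw [real_inner_smul_left]
      split_ifs with hj
      · rfl
      · rw [show v.repr (w i) j = 0 from hr i j (not_le.mp hj)]
        simp
    calc a i * inner ℝ (w i) x ^ 2
        ≤ a i * ((∑ j, r i j ^ 2) * ∑ j, (if j ≤ i then inner ℝ (v j) x else 0) ^ 2) := by
          rw [e]
          exact mul_le_mul_of_nonneg_left (Finset.sum_mul_sq_le_sq_mul_sq _ _ _) (ha0 i)
      _ = (∑ j, r i j ^ 2) * ∑ j, a i * (if j ≤ i then inner ℝ (v j) x else 0) ^ 2 := by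
          rw [← Finset.mul_sum]
          ring
      _ ≤ (∑ j, r i j ^ 2) * S := by
          refine mul_le_mul_of_nonneg_left (Finset.sum_le_sum fun j _ => ?_) (by positivity)
          -- Triangularity leaves only `j ≤ i`, exactly where `a i ≤ a j`.
          split_ifs with hj
          · exact mul_le_mul_of_nonneg_right (ha hj) (sq_nonneg _)
          · simpa using mul_nonneg (ha0 j) (sq_nonneg _)
  calc ∑ i, a i * inner ℝ (w i) x ^ 2 ≤ ∑ i, (∑ j, r i j ^ 2) * S :=
        Finset.sum_le_sum fun i _ => key i
    _ ≤ (1 + ∑ i, ∑ j, r i j ^ 2) * S := by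
        rw [← Finset.sum_mul, add_mul]
        linarith

theorem coe_gramSchmidtONB {m : ℕ} (w : Module.Basis (Fin m) ℝ (EuclideanSpace ℝ (Fin m))) :
    ⇑(gramSchmidtONB w) = InnerProductSpace.gramSchmidtNormed ℝ w := by
  simp [gramSchmidtONB]

theorem span_gramSchmidtONB_Iic {m : ℕ}
    (w : Module.Basis (Fin m) ℝ (EuclideanSpace ℝ (Fin m))) (i : Fin m) :
    Submodule.span ℝ (gramSchmidtONB w '' Set.Iic i) = Submodule.span ℝ (w '' Set.Iic i) := by
  rw [coe_gramSchmidtONB, InnerProductSpace.span_gramSchmidtNormed,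
    InnerProductSpace.span_gramSchmidt_Iic]

/-! ### Sandwiching `H(t)` -/

theorem weightedSum_eq_sumVecMulVec {m : ℕ} (d : Fin m → ℝ)
    (w : Module.Basis (Fin m) ℝ (EuclideanSpace ℝ (Fin m))) (t : ℝ) :
    weightedSum d w t = sumVecMulVec (fun i => Real.exp (t * d i)) w := rfl

theorem matrixRoot_sumVecMulVec_mul_exp {m : ℕ} {c t : ℝ} (hc : 0 < c) (ht : 0 < t)
    (d : Fin m → ℝ) (v : OrthonormalBasis (Fin m) ℝ (EuclideanSpace ℝ (Fin m))) :
    matrixRoot t (sumVecMulVec (fun i => c * Real.exp (t * d i)) v) =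
      sumVecMulVec (fun i => c ^ (1 / t) * Real.exp (d i)) v := by
  rw [matrixRoot, cfc_sumVecMulVec]
  congr 1
  funext i
  rw [Function.comp_apply, Real.mul_rpow hc.le (Real.exp_pos _).le, ← Real.exp_mul]
  congr 2
  field_simp

theorem inner_matrixRoot_le {m : ℕ} {t : ℝ} (ht : 1 ≤ t) {A B : Matrix (Fin m) (Fin m) ℝ}
    (hA : A.PosSemidef) (hB : B.PosSemidef)
    (h : ∀ x, inner ℝ x (Matrix.toEuclideanLin A x) ≤ inner ℝ x (Matrix.toEuclideanLin B x))
    (x : EuclideanSpace ℝ (Fin m)) :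
    inner ℝ x (Matrix.toEuclideanLin (matrixRoot t A) x) ≤
      inner ℝ x (Matrix.toEuclideanLin (matrixRoot t B) x) := by
  have hAB : (B - A).PosSemidef := by
    rw [posSemidef_iff_inner (hB.1.sub hA.1)]
    intro y
    rw [map_sub, LinearMap.sub_apply, inner_sub_right]
    exact sub_nonneg.mpr (h y)
  have key := posSemidef_matrixRoot_sub ht hA hB hAB
  have := (posSemidef_iff_inner key.1).mp key x
  rw [map_sub, LinearMap.sub_apply, inner_sub_right] at this
  exact sub_nonneg.mp this

/-- Two-sided comparison of `H(t)` with its limit, up to factors `c ^ (1 / t)`. -/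
theorem exists_inner_H_bounds {m : ℕ} {d : Fin m → ℝ} (hd : Antitone d)
    (w : Module.Basis (Fin m) ℝ (EuclideanSpace ℝ (Fin m))) :
    ∃ c C : ℝ, 0 < c ∧ 0 < C ∧ ∀ t : ℝ, 1 ≤ t → ∀ x,
      ∑ i, c ^ (1 / t) * Real.exp (d i) * inner ℝ (gramSchmidtONB w i) x ^ 2 ≤
          inner ℝ x (Matrix.toEuclideanLin (H d w t) x) ∧
        inner ℝ x (Matrix.toEuclideanLin (H d w t) x) ≤
          ∑ i, C ^ (1 / t) * Real.exp (d i) * inner ℝ (gramSchmidtONB w i) x ^ 2 := by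
  set u := gramSchmidtONB w
  obtain ⟨C, hC, hwu⟩ := exists_weighted_sum_le (w := w) u.toBasis fun i => by
    rw [u.coe_toBasis, span_gramSchmidtONB_Iic]
    exact Submodule.subset_span ⟨i, Set.mem_Iic.mpr le_rfl, rfl⟩
  -- The reverse comparison expands `u` in the possibly non-orthogonal basis `w`; it yields the
  -- lower constant `K⁻¹`.
  obtain ⟨K, hK, huw⟩ := exists_weighted_sum_le (w := u) w fun i => by
    rw [← span_gramSchmidtONB_Iic]
    exact Submodule.subset_span ⟨i, Set.mem_Iic.mpr le_rfl, rfl⟩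
  refine ⟨K⁻¹, C, inv_pos.mpr hK, hC, fun t ht x => ?_⟩
  have ht0 : 0 < t := by linarith
  have hanti : Antitone fun i => Real.exp (t * d i) := fun i j hij =>
    Real.exp_le_exp.mpr (mul_le_mul_of_nonneg_left (hd hij) ht0.le)
  have hpsd : (weightedSum d w t).PosSemidef := posSemidef_sumVecMulVec (fun i => by positivity) w
  constructor
  · rw [← inner_sumVecMulVec, ← matrixRoot_sumVecMulVec_mul_exp (inv_pos.mpr hK) ht0]
    refine inner_matrixRoot_le ht (posSemidef_sumVecMulVec (fun i => by positivity) _) hpsd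
      (fun y => ?_) x
    rw [inner_sumVecMulVec, weightedSum_eq_sumVecMulVec, inner_sumVecMulVec]
    simp_rw [mul_assoc]
    rw [← Finset.mul_sum, inv_mul_le_iff₀ hK]
    exact huw _ hanti (fun i => by positivity) y
  · rw [← inner_sumVecMulVec, ← matrixRoot_sumVecMulVec_mul_exp hC ht0]
    refine inner_matrixRoot_le ht hpsd (posSemidef_sumVecMulVec (fun i => by positivity) _)
      (fun y => ?_) x
    rw [inner_sumVecMulVec, weightedSum_eq_sumVecMulVec, inner_sumVecMulVec]
    simp_rw [mul_assoc]
    rw [← Finset.mul_sum]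
    simpa using hwu _ hanti (fun i => by positivity) y

/-! ### Passage to the limit -/

theorem tendsto_rpow_one_div {c : ℝ} (hc : 0 < c) :
    Tendsto (fun t : ℝ => c ^ (1 / t)) atTop (𝓝 1) := by
  have h : Tendsto (fun t : ℝ => 1 / t) atTop (𝓝 0) := by
    simpa using tendsto_inv_atTop_zero (𝕜 := ℝ)
  simpa [Function.comp_def] using (Real.continuousAt_const_rpow hc.ne').tendsto.comp h

/-- By polarization, each entry of a symmetric matrix is a fixed linear combination of three values
of its quadratic form. -/
theorem tendsto_of_inner_tendsto {m : ℕ} {ι : Type*} {l : Filter ι}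
    {A : ι → Matrix (Fin m) (Fin m) ℝ} {B : Matrix (Fin m) (Fin m) ℝ}
    (hA : ∀ t, (A t).IsHermitian) (hB : B.IsHermitian)
    (h : ∀ x, Tendsto (fun t => inner ℝ x (Matrix.toEuclideanLin (A t) x)) l
      (𝓝 (inner ℝ x (Matrix.toEuclideanLin B x)))) : Tendsto A l (𝓝 B) := by
  have polar : ∀ {M : Matrix (Fin m) (Fin m) ℝ}, M.IsHermitian → ∀ i j,
      M i j = (inner ℝ (EuclideanSpace.single i 1 + EuclideanSpace.single j 1)
          (Matrix.toEuclideanLin M (EuclideanSpace.single i 1 + EuclideanSpace.single j 1)) -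
        inner ℝ (EuclideanSpace.single i 1)
          (Matrix.toEuclideanLin M (EuclideanSpace.single i 1)) -
        inner ℝ (EuclideanSpace.single j 1)
          (Matrix.toEuclideanLin M (EuclideanSpace.single j 1))) / 2 := by
    intro M hM i j
    have hs : M j i = M i j := by simpa using hM.apply i j
    have e : ∀ k l : Fin m, inner ℝ (EuclideanSpace.single k (1 : ℝ))
        (Matrix.toEuclideanLin M (EuclideanSpace.single l 1)) = M k l := by
      intro k l
      simp [EuclideanSpace.inner_single_left, Matrix.toLpLin_apply]
    simp only [map_add, inner_add_left, inner_add_right, e, hs]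
    ring
  refine tendsto_pi_nhds.mpr fun i => tendsto_pi_nhds.mpr fun j => ?_
  rw [polar hB i j]
  simp_rw [fun t => polar (hA t) i j]
  exact (((h _).sub (h _)).sub (h _)).div_const 2

theorem tendsto_H {m : ℕ} {d : Fin m → ℝ} (hd : Antitone d)
    (w : Module.Basis (Fin m) ℝ (EuclideanSpace ℝ (Fin m))) :
    Tendsto (H d w) atTop
      (𝓝 (sumVecMulVec (fun i => Real.exp (d i)) (gramSchmidtONB w))) := by
  obtain ⟨c, C, hc, hC, hb⟩ := exists_inner_H_bounds hd w
  refine tendsto_of_inner_tendsto (isHermitian_H d w) (isHermitian_sumVecMulVec _ _) fun x => ?_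
  rw [inner_sumVecMulVec]
  have lim : ∀ {c : ℝ}, 0 < c → Tendsto (fun t : ℝ =>
      ∑ i, c ^ (1 / t) * Real.exp (d i) * inner ℝ (gramSchmidtONB w i) x ^ 2) atTop
      (𝓝 (∑ i, Real.exp (d i) * inner ℝ (gramSchmidtONB w i) x ^ 2)) := fun hc =>
    tendsto_finsetSum _ fun i _ => by
      simpa using ((tendsto_rpow_one_div hc).mul_const (Real.exp (d i))).mul_const
        (inner ℝ (gramSchmidtONB w i) x ^ 2)
  refine tendsto_of_tendsto_of_tendsto_of_le_of_le' (lim hc) (lim hC) ?_ ?_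
  · filter_upwards [eventually_ge_atTop 1] with t ht using (hb t ht x).1
  · filter_upwards [eventually_ge_atTop 1] with t ht using (hb t ht x).2

theorem tendsto_nthLargestEigenvalue_H {m : ℕ} {d : Fin m → ℝ} (hd : Antitone d)
    (w : Module.Basis (Fin m) ℝ (EuclideanSpace ℝ (Fin m))) (j : Fin m) :
    Tendsto (fun t : ℝ => nthLargestEigenvalue (isHermitian_H d w t) j) atTop
      (𝓝 (Real.exp (d j))) := by
  obtain ⟨c, C, hc, hC, hb⟩ := exists_inner_H_bounds hd w
  have lim : ∀ {c : ℝ}, 0 < c →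
      Tendsto (fun t : ℝ => c ^ (1 / t) * Real.exp (d j)) atTop (𝓝 (Real.exp (d j))) := fun hc => by
    simpa using (tendsto_rpow_one_div hc).mul_const (Real.exp (d j))
  have hanti : ∀ {c : ℝ}, 0 < c → ∀ t : ℝ, Antitone fun i => c ^ (1 / t) * Real.exp (d i) :=
    fun hc t i k hik => mul_le_mul_of_nonneg_left (Real.exp_le_exp.mpr (hd hik)) (by positivity)
  have hq : ∀ t, ∃ v : OrthonormalBasis (Fin m) ℝ (EuclideanSpace ℝ (Fin m)), ∀ x,
      inner ℝ x (Matrix.toEuclideanLin (H d w t) x) =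
        ∑ i, nthLargestEigenvalue (isHermitian_H d w t) i * inner ℝ (v i) x ^ 2 := fun t => by
    obtain ⟨v, hv⟩ := exists_eq_sumVecMulVec (isHermitian_H d w t)
    refine ⟨v, fun x => ?_⟩
    conv_lhs => rw [hv]
    exact inner_sumVecMulVec _ _ _
  refine tendsto_of_tendsto_of_tendsto_of_le_of_le' (lim hc) (lim hC) ?_ ?_ <;>
  filter_upwards [eventually_ge_atTop 1] with t ht <;> obtain ⟨v, hv⟩ := hq t
  · exact le_of_quadraticForm_le (hanti hc t) (nthLargestEigenvalue_antitone _)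
      (gramSchmidtONB w) v (fun x => (hv x) ▸ (hb t ht x).1) j
  · exact le_of_quadraticForm_le (nthLargestEigenvalue_antitone _) (hanti hC t)
      v (gramSchmidtONB w) (fun x => (hv x) ▸ (hb t ht x).2) j

/-- Eigenvalue monotonicity, applied in both directions to two diagonalizations of the same form,
forces the ordered eigenvalue lists to coincide. -/
theorem roots_charpoly_sumVecMulVec {m : ℕ} {a : Fin m → ℝ} (ha : Antitone a)
    (v : OrthonormalBasis (Fin m) ℝ (EuclideanSpace ℝ (Fin m))) :
    (sumVecMulVec a v).charpoly.roots = Finset.univ.val.map a := by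
  have hL := isHermitian_sumVecMulVec a v
  obtain ⟨u, hu⟩ := exists_eq_sumVecMulVec hL
  have hq : ∀ x, ∑ i, nthLargestEigenvalue hL i * inner ℝ (u i) x ^ 2 =
      ∑ i, a i * inner ℝ (v i) x ^ 2 := fun x => by
    rw [← inner_sumVecMulVec, ← inner_sumVecMulVec, ← hu]
  have hanti := nthLargestEigenvalue_antitone hL
  have e : nthLargestEigenvalue hL = a := funext fun j =>
    le_antisymm (le_of_quadraticForm_le hanti ha u v (fun x => (hq x).le) j)
      (le_of_quadraticForm_le ha hanti v u (fun x => (hq x).ge) j)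
  refine Eq.trans ?_ (congrArg (fun f => Finset.univ.val.map f) e)
  rw [hL.roots_charpoly_eq_eigenvalues₀,
    ← Finset.map_univ_equiv (finCongr (Fintype.card_fin m).symm), Finset.map_val, Multiset.map_map]
  rfl

end SPDLimit

theorem lemma2 {m : ℕ} (d : Fin m → ℝ) (hd : Antitone d)
    (w : Module.Basis (Fin m) ℝ (EuclideanSpace ℝ (Fin m))) :
    -- (a) the ordered eigenvalues of `H(t)` converge
    (∀ j : Fin m,
      Tendsto (fun t : ℝ => SPDLimit.nthLargestEigenvalue (SPDLimit.isHermitian_H d w t) j)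
        atTop (𝓝 (Real.exp (d j)))) ∧
    -- (b) `H(t) u_j → e^{d_j} u_j`
    (∀ j : Fin m,
      Tendsto (fun t : ℝ =>
          Matrix.toEuclideanLin (SPDLimit.H d w t) (SPDLimit.gramSchmidtONB w j))
        atTop (𝓝 (Real.exp (d j) • SPDLimit.gramSchmidtONB w j))) ∧
    -- (c) `H(t)` converges; the limit has eigenvalues `e^{d_j}` (counted with multiplicity) and
    -- corresponding eigenvectors `u_j`
    (∃ L : Matrix (Fin m) (Fin m) ℝ,
      Tendsto (fun t : ℝ => SPDLimit.H d w t) atTop (𝓝 L) ∧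
      L.charpoly.roots = Finset.univ.val.map (fun j : Fin m => Real.exp (d j)) ∧
      ∀ j : Fin m, Module.End.HasEigenvector (Matrix.toEuclideanLin L)
        (Real.exp (d j)) (SPDLimit.gramSchmidtONB w j)) := by
  have hL := SPDLimit.tendsto_H hd w
  have hu : ∀ j, Matrix.toEuclideanLin
      (SPDLimit.sumVecMulVec (fun i => Real.exp (d i)) (SPDLimit.gramSchmidtONB w))
      (SPDLimit.gramSchmidtONB w j) = Real.exp (d j) • SPDLimit.gramSchmidtONB w j := fun j =>
    SPDLimit.toEuclideanLin_sumVecMulVec_basis _ _ j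
  refine ⟨SPDLimit.tendsto_nthLargestEigenvalue_H hd w, fun j => ?_, _, hL,
    SPDLimit.roots_charpoly_sumVecMulVec
      (fun _ _ hij => Real.exp_le_exp.mpr (hd hij)) _, fun j => ?_⟩
  · rw [← hu j]
    have hcont : Continuous fun A : Matrix (Fin m) (Fin m) ℝ =>
        Matrix.toEuclideanLin A (SPDLimit.gramSchmidtONB w j) :=
      (PiLp.continuous_toLp 2 _).comp (continuous_id.matrix_mulVec continuous_const)
    exact (hcont.tendsto _).comp hL
  · exact Module.End.hasEigenvector_iff.mpr ⟨Module.End.mem_eigenspace_iff.mpr (hu j),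
      (SPDLimit.gramSchmidtONB w).orthonormal.ne_zero j⟩
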